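/- Let $O\subset\mathbb{R}^2$ be an open convex polygon with $n\ge 3$ vertices, let $F=\mathbb{R}^2\setminus O$ be the free space, and for each edge $e_i$ let $H_i\subseteq F$ be the closed half plane bounded by the line through $e_i$ on the side away from $O$. Points $x,y\in F$ see each other if $\overline{xy}\cap O=\emptyset$. A watchman route is a continuous map $f:[0,1]\to F$ such that every point of $F$ is seen from some point $f(t)$. Given $s\in F$, an optimal watchman route from $s$ is a watchman route with $f(0)=s$ that has minimal length among all watchman routes starting at $s$. The route $f$ makes a reflection off $H_i$ if at some time it runs along a straight segment from a point outside $H_i$ to a point $p$ on the boundary line of $H_i$ and then (possibly after resting at $p$) along a straight segment from $p$ to a point outside $H_i$, such that the angle of incidence and the angle of return with respect to the boundary line of $H_i$ are equal, in the sense of specular reflection (perpendicular incidence with return along the same line is included). Reflections that occur at different times of arrival, or off different half planes, are counted separately. Then, for every $s\in F$, every optimal watchman route from $s$ makes at most one reflection. Moreover, for every watchman route $f$ starting at $s$ that makes two or more reflections there is a watchman route starting at $s$ that is strictly shorter than $f$. -/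

import Mathlib

open Set

/-- The Euclidean plane. -/
abbrev Plane : Type := EuclideanSpace ℝ (Fin 2)

/-- The planar cross product; `cross u w > 0` iff `w` points strictly to the left of `u`. -/
def cross (u w : Plane) : ℝ := u 0 * w 1 - u 1 * w 0

/-- A (nondegenerate) convex polygon with `n ≥ 3` vertices listed counterclockwise: all vertices
other than the two endpoints of an edge lie strictly to the left of that edge. The index `i + 1` is
taken cyclically in `Fin n`; edge number `i` joins vertex `i` to vertex `i + 1`. -/
structure ConvexPolygon (n : ℕ) [NeZero n] where
  three_le : 3 ≤ n
  vertex : Fin n → Plane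
  left_of_edge : ∀ i j : Fin n, j ≠ i → j ≠ i + 1 →
    0 < cross (vertex (i + 1) - vertex i) (vertex j - vertex i)

/-- The length of a path parametrised by `[0, 1]`. -/
noncomputable def pathLength (f : ℝ → Plane) : ENNReal := eVariationOn f (Icc 0 1)

/-- On the time interval `[a, b]` the path `f` runs monotonically along the straight segment from
`f a` to `f b`. -/
def RunsStraight (f : ℝ → Plane) (a b : ℝ) : Prop :=
  ∃ φ : ℝ → ℝ, MonotoneOn φ (Icc a b) ∧ φ a = 0 ∧ φ b = 1 ∧
    ∀ t ∈ Icc a b, f t = AffineMap.lineMap (f a) (f b) (φ t)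

namespace ConvexPolygon

variable {n : ℕ} [NeZero n]

/-- The obstacle: the open polygon. -/
def obstacle (O : ConvexPolygon n) : Set Plane := interior (convexHull ℝ (range O.vertex))

/-- The free space `F`. -/
def freeSpace (O : ConvexPolygon n) : Set Plane := O.obstacleᶜ

/-- Two points see each other iff the segment between them misses the open obstacle. -/
def Visible (O : ConvexPolygon n) (x y : Plane) : Prop := segment ℝ x y ∩ O.obstacle = ∅

/-- The part of the free space that is seen from some point of `S`. -/
def visibleSet (O : ConvexPolygon n) (S : Set Plane) : Set Plane :=
  {x ∈ O.freeSpace | ∃ y ∈ S, O.Visible x y}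

/-- A path in the free space, parametrised by `[0, 1]`; values outside `[0, 1]` are irrelevant. -/
def IsPath (O : ConvexPolygon n) (f : ℝ → Plane) : Prop :=
  ContinuousOn f (Icc 0 1) ∧ MapsTo f (Icc 0 1) O.freeSpace

/-- A watchman route: a path from which the whole free space is seen. -/
def IsWatchmanRoute (O : ConvexPolygon n) (f : ℝ → Plane) : Prop :=
  O.IsPath f ∧ O.visibleSet (f '' Icc 0 1) = O.freeSpace

/-- A shortest one among all watchman routes starting at `s`. -/
def IsOptimalWatchmanRoute (O : ConvexPolygon n) (s : Plane) (f : ℝ → Plane) : Prop :=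
  O.IsWatchmanRoute f ∧ f 0 = s ∧
    ∀ g : ℝ → Plane, O.IsWatchmanRoute g → g 0 = s → pathLength f ≤ pathLength g

/-- The direction of edge `i`. -/
def edgeDir (O : ConvexPolygon n) (i : Fin n) : Plane := O.vertex (i + 1) - O.vertex i

/-- The closed half plane `H i` bounded by the line of edge `i`, on the side away from the
obstacle. -/
def halfPlane (O : ConvexPolygon n) (i : Fin n) : Set Plane :=
  {x | cross (O.edgeDir i) (x - O.vertex i) ≤ 0}

/-- The line through edge `i`, i.e. the boundary of `H i`. -/
def edgeLine (O : ConvexPolygon n) (i : Fin n) : Set Plane :=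
  {x | cross (O.edgeDir i) (x - O.vertex i) = 0}

/-- At time `t` the path `f` makes a reflection off `H i`: it comes straight from a point `f a`
outside `H i`, arrives at time `t` at a point `f t` of the boundary line of `H i`, possibly rests
there until time `v`, and then goes straight to a point `f b` outside `H i`, and the angle of
incidence with the line equals the angle of return. The two angles are measured against opposite
directions of the line, as in specular reflection. The time `t` is that of the arrival, so that a
rest at `f t` does not count as several reflections. -/
def IsReflection (O : ConvexPolygon n) (f : ℝ → Plane) (i : Fin n) (t : ℝ) : Prop :=
  ∃ a v b : ℝ, 0 ≤ a ∧ a < t ∧ t ≤ v ∧ v < b ∧ b ≤ 1 ∧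
    f a ∉ O.halfPlane i ∧ f t ∈ O.edgeLine i ∧ f b ∉ O.halfPlane i ∧
    RunsStraight f a t ∧ (∀ r ∈ Ico a t, f r ≠ f t) ∧
    (∀ r ∈ Icc t v, f r = f t) ∧ RunsStraight f v b ∧
    InnerProductGeometry.angle (f a - f t) (O.edgeDir i) =
      InnerProductGeometry.angle (f b - f t) (-O.edgeDir i)

/-- All reflections made by `f`, each recorded as the half plane and the time. -/
def reflections (O : ConvexPolygon n) (f : ℝ → Plane) : Set (Fin n × ℝ) :=
  {p | O.IsReflection f p.1 p.2}

end ConvexPolygon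

/-! A path in the free space is a watchman route iff it visits every half plane H_i
(`isWatchmanRoute_iff`): the midpoint M_i of edge i is seen only from H_i, and H_i is convex and
free. So let f be a path of finite length that visits all H_i and reflects off H_i at time t and off
H_j at time t'.

Two reflections at the same time are one: the unit directions x, y would have x + y orthogonal to
two independent edge directions, hence zero, although x and y both point out of H_i (`index_eq`). So
let t < t'.

If H_i is also visited outside the time interval of the reflection, pushing the bend slightly out of
H_i shortens the hairpin (`Reflects.exists_shorter`). No other visit is lost: no three edge lines
concur, so at most one further line passes through the bend, and the push can be chosen to enter its
half plane.

Otherwise f meets H_i only at the point f t and H_j only at f t'. Then every H_k has been visited by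
time t' (`exists_visit_before`), so f can be cut off at t', after which it still moves. The reason
is topological: between the lines of edges i and j the line M_iM_j runs inside the obstacle, so f
never crosses it, and a visit to H_k shows that M_k is on the side of f. If H_k were visited only
after t', then f up to t' would likewise not cross M_iM_k, and M_j would be on its side. At f t, on
the line of edge i, both sides are the same, whereas M_k relative to M_iM_j and M_j relative to
M_iM_k have opposite orientations. -/

lemma cross_lineMap (u x y z : Plane) (t : ℝ) :
    cross u (AffineMap.lineMap x y t - z) = (1 - t) * cross u (x - z) + t * cross u (y - z) := by
  simp [cross, AffineMap.lineMap_apply]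
  ring

lemma continuous_cross_sub (u z : Plane) : Continuous fun x : Plane => cross u (x - z) := by
  unfold cross
  fun_prop

/-- Vectors of the plane satisfy Lagrange's identity. -/
lemma cross_mul_cross_add_inner_mul_inner (d x m : Plane) :
    cross d x * cross d m + inner ℝ x d * inner ℝ m d = inner ℝ x m * inner ℝ d d := by
  simp only [cross, PiLp.inner_apply, Fin.sum_univ_two, RCLike.inner_apply, conj_trivial]
  ring

lemma exists_eq_smul_of_cross_eq_zero {u w : Plane} (hu : u ≠ 0) (h : cross u w = 0) :
    ∃ c : ℝ, w = c • u := by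
  have hd : 0 < inner ℝ u u := real_inner_self_pos.2 hu
  refine ⟨inner ℝ w u / inner ℝ u u, ?_⟩
  ext m
  rw [PiLp.smul_apply, smul_eq_mul, div_mul_eq_mul_div, eq_div_iff hd.ne']
  simp only [PiLp.inner_apply, Fin.sum_univ_two, cross, RCLike.inner_apply, conj_trivial] at h ⊢
  fin_cases m
  · simp; linear_combination (-u 1) * h
  · simp; linear_combination (u 0) * h

/-! ### Side functions, the obstacle as an intersection of half planes, and routes as visits to all
H_i -/

namespace ConvexPolygon

variable {n : ℕ} [NeZero n] (O : ConvexPolygon n)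

/-- The side function of edge `i`: positive strictly to the left of the edge. -/
def side (i : Fin n) (z : Plane) : ℝ := cross (O.edgeDir i) (z - O.vertex i)

/-- The midpoint of edge `i`. -/
noncomputable def edgeMid (i : Fin n) : Plane :=
  AffineMap.lineMap (O.vertex i) (O.vertex (i + 1)) (1 / 2 : ℝ)

lemma mem_halfPlane {i : Fin n} {z : Plane} : z ∈ O.halfPlane i ↔ O.side i z ≤ 0 := Iff.rfl

lemma mem_edgeLine {i : Fin n} {z : Plane} : z ∈ O.edgeLine i ↔ O.side i z = 0 := Iff.rfl

lemma side_lineMap (i : Fin n) (x y : Plane) (t : ℝ) :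
    O.side i (AffineMap.lineMap x y t) = (1 - t) * O.side i x + t * O.side i y :=
  cross_lineMap _ _ _ _ _

lemma side_add (i : Fin n) (x y : Plane) : O.side i (x + y) = O.side i x + cross (O.edgeDir i) y := by
  simp [side, cross]
  ring

lemma continuous_side (i : Fin n) : Continuous (O.side i) := continuous_cross_sub _ _

@[simp] lemma side_vertex_self (i : Fin n) : O.side i (O.vertex i) = 0 := by
  simp [side, cross]

@[simp] lemma side_vertex_succ (i : Fin n) : O.side i (O.vertex (i + 1)) = 0 := by
  simp [side, cross, edgeDir]
  ring

lemma succ_ne (O : ConvexPolygon n) (i : Fin n) : i + 1 ≠ i := by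
  have h := O.three_le
  intro h'
  have := congrArg Fin.val h'
  rw [Fin.val_add_eq_ite, Fin.val_one', Nat.mod_eq_of_lt (by omega)] at this
  split_ifs at this <;> omega

lemma succ_succ_ne (O : ConvexPolygon n) (i : Fin n) : i + 1 + 1 ≠ i := by
  have h := O.three_le
  intro h'
  have := congrArg Fin.val h'
  rw [Fin.val_add_eq_ite, Fin.val_add_eq_ite, Fin.val_one', Nat.mod_eq_of_lt (by omega)] at this
  split_ifs at this <;> omega

lemma side_vertex_pos {i j : Fin n} (h : j ≠ i) (h' : j ≠ i + 1) : 0 < O.side i (O.vertex j) :=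
  O.left_of_edge i j h h'

lemma side_vertex_nonneg (i j : Fin n) : 0 ≤ O.side i (O.vertex j) := by
  by_cases h : j = i
  · simp [h]
  by_cases h' : j = i + 1
  · simp [h']
  exact (O.side_vertex_pos h h').le

@[simp] lemma side_edgeMid_self (i : Fin n) : O.side i (O.edgeMid i) = 0 := by
  simp [edgeMid, side_lineMap]

/-- Of two consecutive vertices at most one lies on another edge line. This strictness is why
midpoints, not vertices, serve as base points below. -/
lemma side_edgeMid_pos {i j : Fin n} (h : j ≠ i) : 0 < O.side i (O.edgeMid j) := by
  rw [edgeMid, side_lineMap]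
  have h1 := O.side_vertex_nonneg i j
  have h2 := O.side_vertex_nonneg i (j + 1)
  by_cases h' : j = i + 1
  · have := O.side_vertex_pos (i := i) (j := j + 1) (by rw [h']; exact O.succ_succ_ne i)
      (by rw [h']; exact O.succ_ne _)
    linarith
  · have := O.side_vertex_pos h h'
    linarith

lemma side_edgeMid_nonneg (i j : Fin n) : 0 ≤ O.side i (O.edgeMid j) := by
  by_cases h : j = i
  · simp [h]
  · exact (O.side_edgeMid_pos h).le

lemma cross_edgeDir_pos (i : Fin n) : 0 < cross (O.edgeDir i) (O.edgeDir (i + 1)) := by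
  have := O.side_vertex_pos (O.succ_succ_ne i) (O.succ_ne (i + 1))
  simp only [side, cross, edgeDir, PiLp.sub_apply] at this ⊢
  linarith

lemma edgeDir_ne_zero (i : Fin n) : O.edgeDir i ≠ 0 := by
  intro h
  have := O.cross_edgeDir_pos i
  simp [h, cross] at this

lemma side_pos_of_mem_obstacle {z : Plane} (hz : z ∈ O.obstacle) (i : Fin n) : 0 < O.side i z := by
  have hull : convexHull ℝ (range O.vertex) ⊆ {x | 0 ≤ O.side i x} := by
    refine convexHull_min ?_ ?_
    · rintro _ ⟨j, rfl⟩
      exact O.side_vertex_nonneg i j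
    · intro x hx y hy a b ha hb hab
      have : a • x + b • y = AffineMap.lineMap x y b := by
        rw [AffineMap.lineMap_apply_module, ← hab]; simp
      simp only [mem_ofPred_eq] at hx hy ⊢
      rw [this, side_lineMap, ← hab, add_sub_cancel_right]
      positivity
  by_contra hneg
  -- move from `z` across the line of edge `i`
  let w : Plane := O.edgeDir (i + 1)
  have hlim : Filter.Tendsto (fun e : ℝ => z + e • (-w)) (nhdsWithin 0 (Ioi 0)) (nhds z) := by
    have : Continuous fun e : ℝ => z + e • (-w) := by fun_prop
    simpa using (this.tendsto 0).mono_left nhdsWithin_le_nhds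
  have hev := hlim.eventually (isOpen_interior.mem_nhds hz)
  obtain ⟨e, he, hepos⟩ := (hev.and self_mem_nhdsWithin).exists
  have h0 : 0 ≤ O.side i (z + e • (-w)) := hull (interior_subset he)
  have h1 : O.side i (z + e • (-w)) = O.side i z - e * cross (O.edgeDir i) w := by
    rw [side_add]
    simp [cross]; ring
  have h2 : 0 < e * cross (O.edgeDir i) w := mul_pos hepos (O.cross_edgeDir_pos i)
  linarith

lemma isOpen_setOf_side_pos : IsOpen {z | ∀ i, 0 < O.side i z} := by
  simp only [ofPred_forall]
  exact isOpen_iInter_of_finite fun i => isOpen_lt continuous_const (O.continuous_side i)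

lemma mem_obstacle {z : Plane} : z ∈ O.obstacle ↔ ∀ i, 0 < O.side i z := by
  refine ⟨O.side_pos_of_mem_obstacle, fun hz => ?_⟩
  refine mem_interior.2 ⟨_, ?_, O.isOpen_setOf_side_pos, hz⟩
  intro y hy
  by_contra hnot
  have hcl : IsClosed (convexHull ℝ (range O.vertex)) :=
    (finite_range O.vertex).isClosed_convexHull ℝ
  obtain ⟨l, c, hl, hc⟩ := geometric_hahn_banach_closed_point (convex_convexHull ℝ _) hcl hnot
  -- At a vertex maximizing `l`, both adjacent edges lead downhill. Since `y` lies in the cone they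
  -- span, `l y` cannot exceed the maximum.
  obtain ⟨k, hk⟩ := Finite.exists_max fun j => l (O.vertex j)
  obtain ⟨i, rfl⟩ : ∃ i : Fin n, k = i + 1 := ⟨k - 1, by simp⟩
  have hD := O.cross_edgeDir_pos i
  set D := cross (O.edgeDir i) (O.edgeDir (i + 1)) with hDdef
  have hβ : 0 < O.side (i + 1) y := hy (i + 1)
  have hα : 0 < O.side i y := hy i
  have key : D • (y - O.vertex (i + 1)) =
      O.side i y • O.edgeDir (i + 1) + O.side (i + 1) y • -O.edgeDir i := by
    ext m
    fin_cases m <;> simp [hDdef, side, cross, edgeDir] <;> ring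
  have h1 := hk i
  have h2 := hk (i + 1 + 1)
  have h3 := hl _ (subset_convexHull ℝ _ (mem_range_self (i + 1)))
  have h4 := congrArg l key
  simp only [map_smul, map_sub, map_add, map_neg, smul_eq_mul, edgeDir] at h4
  have e1 : O.side i y * (l (O.vertex (i + 1 + 1)) - l (O.vertex (i + 1))) ≤ 0 :=
    mul_nonpos_of_nonneg_of_nonpos hα.le (by linarith)
  have e2 : O.side (i + 1) y * -(l (O.vertex (i + 1)) - l (O.vertex i)) ≤ 0 :=
    mul_nonpos_of_nonneg_of_nonpos hβ.le (by linarith)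
  have e3 : 0 < D * (l y - l (O.vertex (i + 1))) := mul_pos hD (by linarith)
  linarith

lemma mem_freeSpace {z : Plane} : z ∈ O.freeSpace ↔ ∃ i, O.side i z ≤ 0 := by
  rw [freeSpace, mem_compl_iff, mem_obstacle]
  simp

lemma mem_freeSpace_of_side_nonpos {z : Plane} {i : Fin n} (h : O.side i z ≤ 0) :
    z ∈ O.freeSpace := O.mem_freeSpace.2 ⟨i, h⟩

lemma side_nonpos_of_mem_segment {i : Fin n} {x y z : Plane} (hx : O.side i x ≤ 0)
    (hy : O.side i y ≤ 0) (hz : z ∈ segment ℝ x y) : O.side i z ≤ 0 := by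
  rw [segment_eq_image_lineMap] at hz
  obtain ⟨t, ht, rfl⟩ := hz
  rw [side_lineMap]
  nlinarith [ht.1, ht.2]

lemma segment_subset_freeSpace {i : Fin n} {x y : Plane} (hx : O.side i x ≤ 0)
    (hy : O.side i y ≤ 0) : segment ℝ x y ⊆ O.freeSpace := fun _ hz =>
  O.mem_freeSpace_of_side_nonpos (O.side_nonpos_of_mem_segment hx hy hz)

/-- A path is a watchman route iff it visits all the half planes. -/
lemma isWatchmanRoute_iff {f : ℝ → Plane} :
    O.IsWatchmanRoute f ↔ O.IsPath f ∧ ∀ i, ∃ t ∈ Icc (0 : ℝ) 1, O.side i (f t) ≤ 0 := by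
  constructor
  · rintro ⟨hf, hv⟩
    refine ⟨hf, fun i => ?_⟩
    have hx : O.edgeMid i ∈ O.freeSpace :=
      O.mem_freeSpace_of_side_nonpos (O.side_edgeMid_self i).le
    rw [← hv] at hx
    obtain ⟨-, _, ⟨t, ht, rfl⟩, hvis⟩ := hx
    refine ⟨t, ht, ?_⟩
    by_contra! hpos
    -- The midpoint is strictly left of all other edges, so a line of sight leaving it to the left
    -- of edge `i` enters the obstacle at once.
    have hev : ∀ᶠ e : ℝ in nhdsWithin 0 (Ioi 0), ∀ j, j ≠ i →
        0 < O.side j (AffineMap.lineMap (O.edgeMid i) (f t) e) := by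
      refine Filter.eventually_all.2 fun j => ?_
      by_cases hj : j = i
      · simp [hj]
      have hc : Continuous fun e : ℝ => O.side j (AffineMap.lineMap (O.edgeMid i) (f t) e) := by
        simp only [side_lineMap]; fun_prop
      have h0 : 0 < O.side j (AffineMap.lineMap (O.edgeMid i) (f t) (0 : ℝ)) := by
        simpa using O.side_edgeMid_pos (Ne.symm hj)
      filter_upwards [((hc.tendsto 0).mono_left nhdsWithin_le_nhds).eventually (lt_mem_nhds h0)]
        with e he _ using he
    obtain ⟨e, he, he1⟩ := (hev.and (Ioo_mem_nhdsGT (zero_lt_one' ℝ))).exists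
    have hmem : AffineMap.lineMap (O.edgeMid i) (f t) e ∈ O.obstacle := by
      refine O.mem_obstacle.2 fun j => ?_
      by_cases hj : j = i
      · subst hj
        rw [side_lineMap, side_edgeMid_self]
        have := mul_pos he1.1 hpos
        linarith
      · exact he j hj
    have hseg : AffineMap.lineMap (O.edgeMid i) (f t) e ∈ segment ℝ (O.edgeMid i) (f t) := by
      rw [segment_eq_image_lineMap]
      exact mem_image_of_mem _ ⟨he1.1.le, he1.2.le⟩
    exact (eq_empty_iff_forall_notMem.1 hvis) _ ⟨hseg, hmem⟩
  · rintro ⟨hf, hv⟩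
    refine ⟨hf, Subset.antisymm (fun x hx => hx.1) fun x hx => ⟨hx, ?_⟩⟩
    obtain ⟨i, hi⟩ := O.mem_freeSpace.1 hx
    obtain ⟨t, ht, hti⟩ := hv i
    refine ⟨f t, mem_image_of_mem f ht, eq_empty_iff_forall_notMem.2 ?_⟩
    rintro z ⟨hz, hzO⟩
    exact O.segment_subset_freeSpace hi hti hz hzO

/-! ### Lines through a common point -/

/-- A point on the line of edge `i` differs from the midpoint by a multiple of the direction. -/
lemma exists_edgeMid_sub_eq_smul {i : Fin n} {p : Plane} (hp : O.side i p = 0) :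
    ∃ c : ℝ, p = O.edgeMid i + c • O.edgeDir i := by
  have h0 : cross (O.edgeDir i) (p - O.edgeMid i) = 0 := by
    have h := O.side_edgeMid_self i
    simp only [side, cross, PiLp.sub_apply] at h hp ⊢
    linarith
  obtain ⟨c, hc⟩ := exists_eq_smul_of_cross_eq_zero (O.edgeDir_ne_zero i) h0
  exact ⟨c, sub_eq_iff_eq_add'.1 hc⟩

lemma side_eq_of_side_eq_zero {i : Fin n} {p : Plane} (hp : O.side i p = 0) (z : Plane) :
    O.side i z = cross (O.edgeDir i) (z - p) := by
  simp only [side, cross, PiLp.sub_apply] at hp ⊢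
  linarith

/-- Parallel lines through `p` would coincide, putting the midpoint of edge `j` on the line of edge
`i`. -/
lemma cross_edgeDir_ne_zero {i j : Fin n} (hij : i ≠ j) {p : Plane} (hi : O.side i p = 0)
    (hj : O.side j p = 0) : cross (O.edgeDir i) (O.edgeDir j) ≠ 0 := by
  intro h
  obtain ⟨c, hc⟩ := O.exists_edgeMid_sub_eq_smul hj
  have h1 := O.side_edgeMid_pos hij.symm
  rw [O.side_eq_of_side_eq_zero hi, hc] at h1
  have : cross (O.edgeDir i) (O.edgeMid j - (O.edgeMid j + c • O.edgeDir j)) =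
      -c * cross (O.edgeDir i) (O.edgeDir j) := by
    simp [cross]; ring
  rw [this, h] at h1
  simp at h1

/-- Seen from a common point of two edge lines, the two edges have opposite orientations. -/
lemma mul_neg_of_side_eq_zero {i j : Fin n} (hij : i ≠ j) {c e : ℝ}
    (hi : O.side j (O.edgeMid i + c • O.edgeDir i) = 0)
    (hj : O.edgeMid i + c • O.edgeDir i = O.edgeMid j + e • O.edgeDir j) : c * e < 0 := by
  have hi' : O.side i (O.edgeMid i + c • O.edgeDir i) = 0 := by
    rw [side_add, side_edgeMid_self]; simp [cross]; ring
  have h1 := O.side_edgeMid_pos hij.symm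
  have h2 := O.side_edgeMid_pos hij
  rw [O.side_eq_of_side_eq_zero hi', hj] at h1
  rw [O.side_eq_of_side_eq_zero hi] at h2
  have e1 : cross (O.edgeDir i) (O.edgeMid j - (O.edgeMid j + e • O.edgeDir j)) =
      -e * cross (O.edgeDir i) (O.edgeDir j) := by
    simp [cross]; ring
  have e2 : cross (O.edgeDir j) (O.edgeMid i - (O.edgeMid i + c • O.edgeDir i)) =
      c * cross (O.edgeDir i) (O.edgeDir j) := by
    simp [cross]; ring
  rw [e1] at h1
  rw [e2] at h2
  by_contra! hce
  have := mul_pos h1 h2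
  nlinarith [mul_nonneg hce (sq_nonneg (cross (O.edgeDir i) (O.edgeDir j)))]

/-- No three edge lines are concurrent. -/
lemma not_concurrent {i j k : Fin n} (hij : i ≠ j) (hik : i ≠ k) (hjk : j ≠ k) {p : Plane}
    (hi : O.side i p = 0) (hj : O.side j p = 0) : O.side k p ≠ 0 := by
  intro hk
  obtain ⟨a, ha⟩ := O.exists_edgeMid_sub_eq_smul hi
  obtain ⟨b, hb⟩ := O.exists_edgeMid_sub_eq_smul hj
  obtain ⟨c, hc⟩ := O.exists_edgeMid_sub_eq_smul hk
  -- Three reals cannot have pairwise opposite signs.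
  have h1 := O.mul_neg_of_side_eq_zero hij (ha ▸ hj) (ha.symm.trans hb)
  have h2 := O.mul_neg_of_side_eq_zero hik (ha ▸ hk) (ha.symm.trans hc)
  have h3 := O.mul_neg_of_side_eq_zero hjk (hb ▸ hk) (hb.symm.trans hc)
  nlinarith [mul_pos_of_neg_of_neg h1 h2, mul_pos_of_neg_of_neg h1 h3, sq_nonneg a, sq_nonneg b,
    sq_nonneg (a * b * c), mul_pos_of_neg_of_neg h2 h3, sq_nonneg c]

end ConvexPolygon

/-! ### Gluing paths -/

/-- The path that follows `f` up to time `c` and `h` afterwards. -/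
noncomputable def glue (f h : ℝ → Plane) (c : ℝ) : ℝ → Plane := fun r => if r ≤ c then f r else h r

lemma glue_of_le {f h : ℝ → Plane} {c r : ℝ} (hr : r ≤ c) : glue f h c r = f r := if_pos hr

lemma glue_of_ge {f h : ℝ → Plane} {c r : ℝ} (hc : f c = h c) (hr : c ≤ r) :
    glue f h c r = h r := by
  rcases hr.eq_or_lt with rfl | hr
  · rw [glue_of_le le_rfl, hc]
  · exact if_neg hr.not_ge

lemma continuousOn_glue {f h : ℝ → Plane} {a c b : ℝ} (hac : a ≤ c) (hcb : c ≤ b)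
    (hf : ContinuousOn f (Icc a c)) (hh : ContinuousOn h (Icc c b)) (hc : f c = h c) :
    ContinuousOn (glue f h c) (Icc a b) := by
  rw [← Icc_union_Icc_eq_Icc hac hcb]
  exact (hf.congr fun r hr => glue_of_le hr.2).union_of_isClosed
    (hh.congr fun r hr => glue_of_ge hc hr.1) isClosed_Icc isClosed_Icc

lemma mapsTo_glue {f h : ℝ → Plane} {a c b : ℝ} {S : Set Plane}
    (hf : MapsTo f (Icc a c) S) (hh : MapsTo h (Icc c b) S) :
    MapsTo (glue f h c) (Icc a b) S := by
  intro r hr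
  rcases le_or_gt r c with h' | h'
  · rw [glue_of_le h']; exact hf ⟨hr.1, h'⟩
  · rw [glue, if_neg h'.not_ge]; exact hh ⟨h'.le, hr.2⟩

lemma eVariationOn_Icc_add {f : ℝ → Plane} {a c b : ℝ} (hac : a ≤ c) (hcb : c ≤ b) :
    eVariationOn f (Icc a c) + eVariationOn f (Icc c b) = eVariationOn f (Icc a b) := by
  simpa using eVariationOn.Icc_add_Icc f (s := univ) hac hcb (mem_univ c)

lemma eVariationOn_glue {f h : ℝ → Plane} {a c b : ℝ} (hac : a ≤ c) (hcb : c ≤ b)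
    (hc : f c = h c) :
    eVariationOn (glue f h c) (Icc a b) = eVariationOn f (Icc a c) + eVariationOn h (Icc c b) := by
  rw [← eVariationOn_Icc_add hac hcb,
    eVariationOn.eq_of_eqOn (fun r hr => glue_of_le hr.2 : EqOn (glue f h c) f (Icc a c)),
    eVariationOn.eq_of_eqOn (fun r hr => glue_of_ge hc hr.1 : EqOn (glue f h c) h (Icc c b))]

/-- The path that runs along the segment from `A` to `B` during `[c, d]`. -/
noncomputable def segPath (A B : Plane) (c d : ℝ) : ℝ → Plane :=
  fun r => AffineMap.lineMap A B ((r - c) / (d - c))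

@[simp] lemma segPath_left (A B : Plane) (c d : ℝ) : segPath A B c d c = A := by
  simp [segPath]

lemma segPath_right (A B : Plane) {c d : ℝ} (h : c < d) : segPath A B c d d = B := by
  simp [segPath, div_self (sub_pos.2 h).ne']

lemma continuous_segPath (A B : Plane) (c d : ℝ) : Continuous (segPath A B c d) := by
  unfold segPath
  fun_prop

lemma mapsTo_segPath (A B : Plane) {c d : ℝ} (h : c < d) :
    MapsTo (segPath A B c d) (Icc c d) (segment ℝ A B) := by
  intro r hr
  rw [segment_eq_image_lineMap]
  have := sub_pos.2 h
  refine mem_image_of_mem _ ⟨div_nonneg (by linarith [hr.1]) this.le, ?_⟩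
  rw [div_le_one this]
  linarith [hr.2]

lemma eVariationOn_segPath_le (A B : Plane) {c d : ℝ} (h : c < d) :
    eVariationOn (segPath A B c d) (Icc c d) ≤ edist A B := by
  have hL : LipschitzWith (nndist A B) (AffineMap.lineMap A B : ℝ → Plane) :=
    lipschitzWith_lineMap A B
  have hd := sub_pos.2 h
  have hmono : MonotoneOn (fun r => (r - c) / (d - c)) (Icc c d) := fun x _ y _ hxy => by
    dsimp only
    gcongr
  calc eVariationOn (segPath A B c d) (Icc c d)
      ≤ nndist A B * eVariationOn (fun r => (r - c) / (d - c)) (Icc c d) :=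
        (hL.lipschitzOnWith (s := univ)).comp_eVariationOn_le (mapsTo_univ _ _)
    _ ≤ nndist A B * ENNReal.ofReal ((d - c) / (d - c) - (c - c) / (d - c)) := by
        gcongr
        simpa using (hmono.eVariationOn_eq (left_mem_Icc.2 h.le) (right_mem_Icc.2 h.le)).le
    _ = edist A B := by
        rw [div_self hd.ne']
        rw [edist_nndist]
        simp

/-! ### Detours, prolongations and routes of finite length -/

namespace ConvexPolygon

variable {n : ℕ} [NeZero n] (O : ConvexPolygon n)

/-- Replacing the part of a path during `[α, β]` by two segments. -/
lemma exists_detour {f : ℝ → Plane} (hf : O.IsPath f) {α β : ℝ} (hα : 0 ≤ α) (hαβ : α < β)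
    (hβ : β ≤ 1) {q : Plane} (h1 : segment ℝ (f α) q ⊆ O.freeSpace)
    (h2 : segment ℝ q (f β) ⊆ O.freeSpace) :
    ∃ g : ℝ → Plane, O.IsPath g ∧ (∀ r, r ≤ α ∨ β ≤ r → g r = f r) ∧
      (∃ r ∈ Icc (0 : ℝ) 1, g r = q) ∧
      pathLength g ≤ eVariationOn f (Icc 0 α) + (edist (f α) q + (edist q (f β) +
        eVariationOn f (Icc β 1))) := by
  obtain ⟨γ, hγ1, hγ2⟩ := exists_between hαβ
  have e3 : segPath q (f β) γ β β = f β := segPath_right _ _ hγ2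
  have e2 : segPath (f α) q α γ γ = glue (segPath q (f β) γ β) f β γ := by
    rw [glue_of_le hγ2.le, segPath_left, segPath_right _ _ hγ1]
  have e1 : f α = glue (segPath (f α) q α γ) (glue (segPath q (f β) γ β) f β) γ α := by
    rw [glue_of_le hγ1.le, segPath_left]
  refine ⟨glue f (glue (segPath (f α) q α γ) (glue (segPath q (f β) γ β) f β) γ) α,
    ⟨?_, ?_⟩, ?_, ⟨γ, ⟨by linarith, by linarith⟩, ?_⟩, ?_⟩
  · refine continuousOn_glue hα (by linarith) (hf.1.mono (Icc_subset_Icc_right (by linarith)))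
      (continuousOn_glue hγ1.le (by linarith) (continuous_segPath _ _ _ _).continuousOn
      (continuousOn_glue hγ2.le hβ (continuous_segPath _ _ _ _).continuousOn
      (hf.1.mono (Icc_subset_Icc_left (by linarith))) e3) e2) e1
  · exact mapsTo_glue (hf.2.mono_left (Icc_subset_Icc_right (by linarith)))
      (mapsTo_glue ((mapsTo_segPath _ _ hγ1).mono_right h1)
      (mapsTo_glue ((mapsTo_segPath _ _ hγ2).mono_right h2)
      (hf.2.mono_left (Icc_subset_Icc_left (by linarith)))))
  · rintro r (hr | hr)
    · exact glue_of_le hr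
    · rw [glue_of_ge e1 (by linarith), glue_of_ge e2 (by linarith), glue_of_ge e3 hr]
  · rw [glue_of_ge e1 hγ1.le, glue_of_le le_rfl, segPath_right _ _ hγ1]
  · rw [pathLength, eVariationOn_glue hα (by linarith) e1,
      eVariationOn_glue hγ1.le (by linarith) e2, eVariationOn_glue hγ2.le hβ e3]
    gcongr
    · exact eVariationOn_segPath_le _ _ hγ1
    · exact eVariationOn_segPath_le _ _ hγ2

/-- Counterpart of the bound in `exists_detour`, with the old bend `f τ` in place of `q`: lengths
are then compared through two hairpins only. -/
lemma le_pathLength_of_mem {f : ℝ → Plane} {α τ β : ℝ} (hα : 0 ≤ α) (hατ : α ≤ τ) (hτβ : τ ≤ β)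
    (hβ : β ≤ 1) :
    eVariationOn f (Icc 0 α) + (edist (f α) (f τ) + (edist (f τ) (f β) +
      eVariationOn f (Icc β 1))) ≤ pathLength f := by
  rw [pathLength, ← eVariationOn_Icc_add hα (by linarith : α ≤ 1),
    ← eVariationOn_Icc_add hατ (by linarith : τ ≤ 1), ← eVariationOn_Icc_add hτβ hβ]
  gcongr
  · exact eVariationOn.edist_le f (left_mem_Icc.2 hατ) (right_mem_Icc.2 hατ)
  · exact eVariationOn.edist_le f (left_mem_Icc.2 hτβ) (right_mem_Icc.2 hτβ)

lemma eVariationOn_comp_mul (f : ℝ → Plane) {c : ℝ} (hc : 0 ≤ c) :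
    eVariationOn (fun r => f (c * r)) (Icc 0 1) = eVariationOn f (Icc 0 c) := by
  have hm : MonotoneOn (fun r : ℝ => c * r) (Icc 0 1) := fun x _ y _ h =>
    mul_le_mul_of_nonneg_left h hc
  have him : (fun r : ℝ => c * r) '' Icc 0 1 = Icc 0 c := by
    simpa using image_mul_left_Icc hc (zero_le_one' ℝ)
  rw [← him]
  exact eVariationOn.comp_eq_of_monotoneOn f _ hm

/-- Prolonging a path by a segment. -/
lemma exists_append {f : ℝ → Plane} (hf : O.IsPath f) (hfin : pathLength f ≠ ⊤) {y : Plane}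
    (hy : segment ℝ (f 1) y ⊆ O.freeSpace) :
    ∃ g : ℝ → Plane, O.IsPath g ∧ pathLength g ≠ ⊤ ∧ g 0 = f 0 ∧ g 1 = y ∧
      f '' Icc 0 1 ⊆ g '' Icc 0 1 := by
  have hmap : MapsTo (fun r : ℝ => 2 * r) (Icc 0 (1 / 2)) (Icc 0 1) := fun r hr =>
    ⟨by linarith [hr.1], by linarith [hr.2]⟩
  have e : (fun r => f (2 * r)) (1 / 2) = segPath (f 1) y (1 / 2) 1 (1 / 2) := by simp
  have hlt : (1 / 2 : ℝ) < 1 := by norm_num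
  refine ⟨glue (fun r => f (2 * r)) (segPath (f 1) y (1 / 2) 1) (1 / 2), ⟨?_, ?_⟩, ?_, ?_, ?_, ?_⟩
  · exact continuousOn_glue (by norm_num) hlt.le (hf.1.comp (by fun_prop) hmap)
      (continuous_segPath _ _ _ _).continuousOn e
  · exact mapsTo_glue (hf.2.comp hmap) ((mapsTo_segPath _ _ hlt).mono_right hy)
  · rw [pathLength, eVariationOn_glue (by norm_num) hlt.le e]
    refine ENNReal.add_ne_top.2 ⟨ne_top_of_le_ne_top hfin ?_, ?_⟩
    · exact eVariationOn.comp_le_of_monotoneOn f _ (fun x _ y _ h => by linarith) hmap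
    · exact ne_top_of_le_ne_top (edist_ne_top _ _) (eVariationOn_segPath_le _ _ hlt)
  · rw [glue_of_le (by norm_num)]; simp
  · rw [glue_of_ge e hlt.le, segPath_right _ _ hlt]
  · rintro _ ⟨r, hr, rfl⟩
    refine ⟨r / 2, ⟨by linarith [hr.1], by linarith [hr.2]⟩, ?_⟩
    rw [glue_of_le (by linarith [hr.2])]
    ring_nf

lemma segment_edge_subset (i : Fin n) :
    segment ℝ (O.vertex i) (O.vertex (i + 1)) ⊆ O.freeSpace :=
  O.segment_subset_freeSpace (O.side_vertex_self i).le (O.side_vertex_succ i).le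

/-- From every point of the free space there is a watchman route of finite length. -/
lemma exists_finite_route {s : Plane} (hs : s ∈ O.freeSpace) :
    ∃ g : ℝ → Plane, O.IsWatchmanRoute g ∧ g 0 = s ∧ pathLength g ≠ ⊤ := by
  obtain ⟨i, hi⟩ := O.mem_freeSpace.1 hs
  -- Go to a vertex of the edge whose half plane contains `s`, then walk around the polygon.
  have main : ∀ k : ℕ, ∃ g : ℝ → Plane, O.IsPath g ∧ pathLength g ≠ ⊤ ∧ g 0 = s ∧
      g 1 = O.vertex (i + Fin.ofNat n k) ∧
      ∀ m ≤ k, O.vertex (i + Fin.ofNat n m) ∈ g '' Icc 0 1 := by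
    intro k
    induction k with
    | zero =>
      have hp : O.IsPath fun _ => s := ⟨continuousOn_const, fun _ _ => hs⟩
      obtain ⟨g, h1, h2, h3, h4, -⟩ := O.exists_append hp
        (by
          have h0 : pathLength (fun _ => s) = 0 := eVariationOn.constant_on
            (by rintro _ ⟨_, _, rfl⟩ _ ⟨_, _, rfl⟩; rfl)
          simp [h0])
        (O.segment_subset_freeSpace hi (O.side_vertex_self i).le)
      have hz : i + Fin.ofNat n 0 = i := by simp
      refine ⟨g, h1, h2, h3, by rw [h4, hz], fun m hm => ⟨1, by simp, ?_⟩⟩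
      rw [Nat.le_zero.1 hm, h4, hz]
    | succ k ih =>
      obtain ⟨g, h1, h2, h3, h4, h5⟩ := ih
      have hz : i + Fin.ofNat n (k + 1) = i + Fin.ofNat n k + 1 := by
        ext; simp [Fin.val_add, add_assoc]
      have hseg := O.segment_edge_subset (i + Fin.ofNat n k)
      rw [← h4, ← hz] at hseg
      obtain ⟨g', k1, k2, k3, k4, k5⟩ := O.exists_append h1 h2 hseg
      refine ⟨g', k1, k2, k3.trans h3, k4, fun m hm => ?_⟩
      rcases Nat.le_succ_iff.1 hm with hm | rfl
      · exact k5 (h5 m hm)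
      · exact ⟨1, by simp, k4⟩
  obtain ⟨g, h1, h2, h3, -, h5⟩ := main n
  refine ⟨g, O.isWatchmanRoute_iff.2 ⟨h1, fun j => ?_⟩, h3, h2⟩
  obtain ⟨t, ht, hgt⟩ := h5 (j - i).val (j - i).isLt.le
  refine ⟨t, ht, ?_⟩
  rw [hgt, Fin.ofNat_val_eq_self, add_sub_cancel, side_vertex_self]

end ConvexPolygon

lemma cross_add (u x y : Plane) : cross u (x + y) = cross u x + cross u y := by
  simp only [cross, PiLp.add_apply]
  ring

lemma cross_smul (u x : Plane) (c : ℝ) : cross u (c • x) = c * cross u x := by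
  simp only [cross, PiLp.smul_apply, smul_eq_mul]
  ring

lemma plane_cross_self (u : Plane) : cross u u = 0 := by
  simp only [cross]
  ring

lemma cross_swap (u w : Plane) : cross w u = -cross u w := by
  simp only [cross]
  ring

/-! ### Straight runs -/

lemma lineMap_sub_eq_norm_smul (A B : Plane) {c : ℝ} (hc : 0 ≤ c) :
    AffineMap.lineMap A B c = A + dist (AffineMap.lineMap A B c) A • (‖B - A‖⁻¹ • (B - A)) := by
  have h1 : dist (AffineMap.lineMap A B c) A = c * ‖B - A‖ := by
    rw [dist_lineMap_left, Real.norm_of_nonneg hc, dist_comm, dist_eq_norm]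
  rcases eq_or_ne B A with rfl | h
  · simp
  · have : ‖B - A‖ ≠ 0 := norm_ne_zero_iff.2 (sub_ne_zero.2 h)
    rw [h1, smul_smul, mul_assoc, mul_inv_cancel₀ this, mul_one, AffineMap.lineMap_apply]
    simp [add_comm]

/-- The distance replaces the parameter `φ`, which is not assumed continuous; for continuous `f` the
distance takes all intermediate values. -/
lemma RunsStraight.departure {f : ℝ → Plane} {v b : ℝ} (h : RunsStraight f v b) (hvb : v ≤ b) :
    (∀ r ∈ Icc v b, f r = f v + dist (f r) (f v) • (‖f b - f v‖⁻¹ • (f b - f v))) ∧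
      MonotoneOn (fun r => dist (f r) (f v)) (Icc v b) := by
  obtain ⟨φ, hmono, h0, h1, hφ⟩ := h
  have hpos : ∀ r ∈ Icc v b, 0 ≤ φ r := fun r hr => h0 ▸ hmono (left_mem_Icc.2 hvb) hr hr.1
  constructor
  · intro r hr
    rw [hφ r hr]
    exact lineMap_sub_eq_norm_smul _ _ (hpos r hr)
  · intro r hr r' hr' hrr
    dsimp only
    rw [hφ r hr, hφ r' hr', dist_lineMap_left, dist_lineMap_left,
      Real.norm_of_nonneg (hpos r hr), Real.norm_of_nonneg (hpos r' hr')]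
    exact mul_le_mul_of_nonneg_right (hmono hr hr' hrr) dist_nonneg

lemma RunsStraight.arrival {f : ℝ → Plane} {a t : ℝ} (h : RunsStraight f a t) (hat : a ≤ t) :
    (∀ r ∈ Icc a t, f r = f t + dist (f r) (f t) • (‖f a - f t‖⁻¹ • (f a - f t))) ∧
      AntitoneOn (fun r => dist (f r) (f t)) (Icc a t) := by
  obtain ⟨φ, hmono, h0, h1, hφ⟩ := h
  have hpos : ∀ r ∈ Icc a t, 0 ≤ 1 - φ r := fun r hr =>
    sub_nonneg.2 (h1 ▸ hmono hr (right_mem_Icc.2 hat) hr.2)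
  have hφ' : ∀ r ∈ Icc a t, f r = AffineMap.lineMap (f t) (f a) (1 - φ r) := fun r hr => by
    rw [AffineMap.lineMap_apply_one_sub]; exact hφ r hr
  constructor
  · intro r hr
    rw [hφ' r hr]
    exact lineMap_sub_eq_norm_smul _ _ (hpos r hr)
  · intro r hr r' hr' hrr
    dsimp only
    rw [hφ' r hr, hφ' r' hr', dist_lineMap_left, dist_lineMap_left,
      Real.norm_of_nonneg (hpos r hr), Real.norm_of_nonneg (hpos r' hr')]
    exact mul_le_mul_of_nonneg_right (sub_le_sub_left (hmono hr hr' hrr) 1) dist_nonneg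

/-- Moving the bend of a symmetric hairpin towards its ends shortens it. -/
lemma norm_sub_add_norm_sub_lt {x y m : Plane} {δ ε : ℝ} (hδ : 0 < δ) (hx : ‖x‖ = δ)
    (hy : ‖y‖ = δ) (hε : 0 < ε) (h : ε * ‖m‖ ^ 2 < inner ℝ (x + y) m) :
    ‖x - ε • m‖ + ‖y - ε • m‖ < δ + δ := by
  have h1 : ‖x - ε • m‖ ^ 2 = δ ^ 2 - 2 * (ε * inner ℝ x m) + ε ^ 2 * ‖m‖ ^ 2 := by
    rw [norm_sub_sq_real, inner_smul_right, norm_smul, Real.norm_of_nonneg hε.le, hx]; ring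
  have h2 : ‖y - ε • m‖ ^ 2 = δ ^ 2 - 2 * (ε * inner ℝ y m) + ε ^ 2 * ‖m‖ ^ 2 := by
    rw [norm_sub_sq_real, inner_smul_right, norm_smul, Real.norm_of_nonneg hε.le, hy]; ring
  rw [inner_add_left] at h
  have h3 := mul_lt_mul_of_pos_left h hε
  refine lt_of_pow_lt_pow_left₀ 2 (by linarith) ?_
  -- By `h1` to `h3` the squares sum to less than 2δ², and (p + q)² ≤ 2(p² + q²).
  nlinarith [sq_nonneg (‖x - ε • m‖ - ‖y - ε • m‖)]

/-! ### Reflections and the local shortening of a hairpin -/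

namespace ConvexPolygon

variable {n : ℕ} [NeZero n] (O : ConvexPolygon n)

/-- The geometric content of a reflection off edge line `i` at time `t` with unit directions `x`
(pointing back along the incoming run) and `y` (along the outgoing run). -/
structure Reflects (f : ℝ → Plane) (i : Fin n) (t a b : ℝ) (x y : Plane) : Prop where
  nonneg : 0 ≤ a
  lt_time : a < t
  time_lt : t < b
  le_one : b ≤ 1
  side_eq : O.side i (f t) = 0
  norm_in : ‖x‖ = 1
  norm_out : ‖y‖ = 1
  cross_in : 0 < cross (O.edgeDir i) x
  cross_out : 0 < cross (O.edgeDir i) y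
  inner_eq : inner ℝ (x + y) (O.edgeDir i) = 0
  before : ∀ r ∈ Ico a t, ∃ c > (0 : ℝ), f r = f t + c • x
  after : ∀ r ∈ Icc t b, ∃ c ≥ (0 : ℝ), f r = f t + c • y
  near : ∃ δ₀ > (0 : ℝ), ∀ δ > (0 : ℝ), δ ≤ δ₀ → ∃ a' ∈ Ico a t, ∃ b' ∈ Ioc t b,
    f a' = f t + δ • x ∧ f b' = f t + δ • y ∧ ∀ r ∈ Icc a' b', dist (f r) (f t) ≤ δ

/-- The rest at the bend is absorbed into the outgoing interval, so the coefficient is strictly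
positive before `t` but may vanish after it. The intermediate value theorem gives times at equal
distance δ on both runs, which makes the hairpin symmetric. -/
lemma IsReflection.exists_reflects {O : ConvexPolygon n} {f : ℝ → Plane} {i : Fin n} {t : ℝ}
    (hf : ContinuousOn f (Icc 0 1)) (h : O.IsReflection f i t) :
    ∃ a b x y, O.Reflects f i t a b x y := by
  obtain ⟨a, v, b, ha, hat, htv, hvb, hb, hfa, hft, hfb, hin, hne, hrest, hout, hang⟩ := h
  have hv : f v = f t := hrest v ⟨htv, le_rfl⟩
  obtain ⟨in1, in2⟩ := hin.arrival hat.le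
  obtain ⟨out1, out2⟩ := hout.departure hvb.le
  rw [hv] at out1 out2
  rw [mem_halfPlane, not_le] at hfa hfb
  rw [mem_edgeLine] at hft
  have hua : f a - f t ≠ 0 := fun h0 => by
    rw [sub_eq_zero.1 h0, hft] at hfa; exact lt_irrefl _ hfa
  have hub : f b - f t ≠ 0 := fun h0 => by
    rw [sub_eq_zero.1 h0, hft] at hfb; exact lt_irrefl _ hfb
  rw [O.side_eq_of_side_eq_zero hft] at hfa hfb
  have hca : ContinuousOn (fun r => dist (f r) (f t)) (Icc a t) :=
    continuous_dist.comp_continuousOn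
      ((hf.mono (Icc_subset_Icc ha (by linarith))).prodMk continuousOn_const)
  have hcb : ContinuousOn (fun r => dist (f r) (f t)) (Icc v b) :=
    continuous_dist.comp_continuousOn
      ((hf.mono (Icc_subset_Icc (by linarith) hb)).prodMk continuousOn_const)
  have hpa := norm_pos_iff.2 hua
  have hpb := norm_pos_iff.2 hub
  have hunit : ∀ {z : Plane}, z ≠ 0 → ‖‖z‖⁻¹ • z‖ = 1 := fun hz => by
    rw [norm_smul, norm_inv, norm_norm, inv_mul_cancel₀ (norm_ne_zero_iff.2 hz)]
  refine ⟨a, b, ‖f a - f t‖⁻¹ • (f a - f t), ‖f b - f t‖⁻¹ • (f b - f t), ha, hat,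
    htv.trans_lt hvb, hb, hft, hunit hua, hunit hub, ?_, ?_, ?_, ?_, ?_, ?_⟩
  · rw [cross_smul]
    positivity
  · rw [cross_smul]
    positivity
  · have hcos := congrArg Real.cos hang
    rw [InnerProductGeometry.cos_angle, InnerProductGeometry.cos_angle, norm_neg, inner_neg_right,
      mul_comm ‖f a - f t‖, mul_comm ‖f b - f t‖, ← div_div, ← div_div, div_right_comm,
      div_right_comm (-_), div_left_inj' (norm_ne_zero_iff.2 (O.edgeDir_ne_zero i))] at hcos
    rw [inner_add_left, real_inner_smul_left, real_inner_smul_left, inv_mul_eq_div, inv_mul_eq_div,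
      hcos]
    ring
  · intro r hr
    exact ⟨dist (f r) (f t), dist_pos.2 (hne r hr), in1 r ⟨hr.1, hr.2.le⟩⟩
  · intro r hr
    rcases le_total r v with hrv | hrv
    · exact ⟨0, le_rfl, by rw [hrest r ⟨hr.1, hrv⟩]; simp⟩
    · exact ⟨dist (f r) (f t), dist_nonneg, out1 r ⟨hrv, hr.2⟩⟩
  · refine ⟨min ‖f a - f t‖ ‖f b - f t‖, by positivity, fun δ hδ hδle => ?_⟩
    have ka : dist (f a) (f t) = ‖f a - f t‖ := dist_eq_norm _ _
    have kb : dist (f b) (f t) = ‖f b - f t‖ := dist_eq_norm _ _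
    obtain ⟨a', ha', ea⟩ := intermediate_value_Icc' hat.le hca
      (show δ ∈ Icc (dist (f t) (f t)) (dist (f a) (f t)) from
        ⟨by simpa using hδ.le, ka ▸ hδle.trans (min_le_left _ _)⟩)
    obtain ⟨b', hb', eb⟩ := intermediate_value_Icc hvb.le hcb
      (show δ ∈ Icc (dist (f v) (f t)) (dist (f b) (f t)) from
        ⟨by simpa [hv] using hδ.le, kb ▸ hδle.trans (min_le_right _ _)⟩)
    dsimp only at ea eb
    have hat' : a' < t := lt_of_le_of_ne ha'.2 fun e => by
      rw [e, dist_self] at ea; exact hδ.ne ea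
    have hvb' : v < b' := lt_of_le_of_ne hb'.1 fun e => by
      rw [← e, hv, dist_self] at eb; exact hδ.ne eb
    refine ⟨a', ⟨ha'.1, hat'⟩, b', ⟨htv.trans_lt hvb', hb'.2⟩, ?_, ?_, fun r hr => ?_⟩
    · rw [in1 a' ha', ea]
    · rw [out1 b' hb', eb]
    · rcases le_total r t with hrt | hrt
      · exact ea ▸ in2 ha' ⟨ha'.1.trans hr.1, hrt⟩ hr.1
      rcases le_total r v with hrv | hrv
      · rw [hrest r ⟨hrt, hrv⟩, dist_self]; exact hδ.le
      · exact eb ▸ out2 ⟨hrv, hr.2.trans hb'.2⟩ hb' hr.2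

/-- Used in two ways: a half plane that contains a nearby point contains `p`, and one that contains
`p` in its interior contains all nearby points. -/
lemma eventually_side_sign (p : Plane) : ∀ᶠ z in nhds p, ∀ j,
    (0 < O.side j p → 0 < O.side j z) ∧ (O.side j p < 0 → O.side j z < 0) := by
  refine Filter.eventually_all.2 fun j => ?_
  have hc := (O.continuous_side j).tendsto p
  refine Filter.Eventually.and ?_ ?_
  · by_cases h : 0 < O.side j p
    · filter_upwards [hc.eventually (lt_mem_nhds h)] with z hz _ using hz
    · simp [h]
  · by_cases h : O.side j p < 0
    · filter_upwards [hc.eventually (gt_mem_nhds h)] with z hz _ using hz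
    · simp [h]

namespace Reflects

variable {O} {f : ℝ → Plane} {i : Fin n} {t a b : ℝ} {x y : Plane}

lemma side_add_smul (h : O.Reflects f i t a b x y) (c : ℝ) (z : Plane) :
    O.side i (f t + c • z) = c * cross (O.edgeDir i) z := by
  rw [side_add, h.side_eq, cross_smul, zero_add]

lemma eq_of_side_nonpos (h : O.Reflects f i t a b x y) {r : ℝ} (hr : r ∈ Icc a b)
    (hs : O.side i (f r) ≤ 0) : f r = f t := by
  rcases lt_or_ge r t with hrt | hrt
  · obtain ⟨c, hc, e⟩ := h.before r ⟨hr.1, hrt⟩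
    rw [e, h.side_add_smul] at hs
    exact absurd (mul_pos hc h.cross_in) hs.not_gt
  · obtain ⟨c, hc, e⟩ := h.after r ⟨hrt, hr.2⟩
    rw [e, h.side_add_smul] at hs
    rcases hc.lt_or_eq with hc | rfl
    · exact absurd (mul_pos hc h.cross_out) hs.not_gt
    · simpa using e

lemma time_mem (h : O.Reflects f i t a b x y) : t ∈ Icc (0 : ℝ) 1 :=
  ⟨h.nonneg.trans h.lt_time.le, h.time_lt.le.trans h.le_one⟩

/-- Near the point of reflection the path lies in another half plane. -/
lemma exists_side_nonpos (h : O.Reflects f i t a b x y) (hf : O.IsPath f) :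
    ∃ j ≠ i, O.side j (f t) ≤ 0 := by
  obtain ⟨ρ, hρ, hball⟩ := Metric.eventually_nhds_iff_ball.1 (O.eventually_side_sign (f t))
  obtain ⟨δ₀, hδ₀, hnear⟩ := h.near
  obtain ⟨a', ha', b', hb', ea, eb, hd⟩ := hnear (min δ₀ (ρ / 2)) (by positivity) (min_le_left _ _)
  have hmem : a' ∈ Icc (0 : ℝ) 1 := ⟨h.nonneg.trans ha'.1, ha'.2.le.trans h.time_mem.2⟩
  obtain ⟨j, hj⟩ := O.mem_freeSpace.1 (hf.2 hmem)
  refine ⟨j, ?_, ?_⟩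
  · rintro rfl
    rw [ea, h.side_add_smul] at hj
    exact absurd (mul_pos (by positivity) h.cross_in) hj.not_gt
  · by_contra! hpos
    have hb : f a' ∈ Metric.ball (f t) ρ := Metric.mem_ball.2
      ((hd a' ⟨le_rfl, ha'.2.le.trans hb'.1.le⟩).trans_lt
        ((min_le_right _ _).trans_lt (by linarith)))
    exact absurd ((hball _ hb j).1 hpos) hj.not_gt

/-- A direction that leaves `H i` and enters the other half plane whose boundary line passes
through the point of reflection, if there is one. -/
lemma exists_push (h : O.Reflects f i t a b x y) :
    ∃ m, 0 < cross (O.edgeDir i) m ∧ ∀ j ≠ i, O.side j (f t) = 0 → cross (O.edgeDir j) m < 0 := by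
  by_cases hj : ∃ j ≠ i, O.side j (f t) = 0
  · obtain ⟨j, hji, hj⟩ := hj
    have hc := O.cross_edgeDir_ne_zero hji.symm h.side_eq hj
    have hc2 := sq_pos_of_ne_zero hc
    refine ⟨cross (O.edgeDir i) (O.edgeDir j) • (O.edgeDir i + O.edgeDir j), ?_, ?_⟩
    · rw [cross_smul, cross_add, plane_cross_self]
      linarith
    · intro k hki hk
      obtain rfl : k = j := by
        by_contra hkj
        exact O.not_concurrent hji.symm (Ne.symm hki) (Ne.symm hkj) h.side_eq hj hk
      rw [← neg_pos]
      rw [cross_smul, cross_add, plane_cross_self, cross_swap (O.edgeDir i) (O.edgeDir k)]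
      linarith
  · push Not at hj
    exact ⟨x, h.cross_in, fun j hji hj0 => absurd hj0 (hj j hji)⟩

/-- Equal angles make `x + y` a positive multiple of the normal that points out of `H i`. -/
lemma inner_pos (h : O.Reflects f i t a b x y) {m : Plane} (hm : 0 < cross (O.edgeDir i) m) :
    0 < inner ℝ (x + y) m := by
  have hd : 0 < inner ℝ (O.edgeDir i) (O.edgeDir i) := real_inner_self_pos.2 (O.edgeDir_ne_zero i)
  have hL := cross_mul_cross_add_inner_mul_inner (O.edgeDir i) (x + y) m
  rw [h.inner_eq, zero_mul, add_zero] at hL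
  have := mul_pos (add_pos h.cross_in h.cross_out) hm
  rw [← cross_add, hL] at this
  exact pos_of_mul_pos_left this hd.le

/-- A route that visits `H i` also at another time can be shortened near a reflection off `H i`. -/
lemma exists_shorter (h : O.Reflects f i t a b x y) (hf : O.IsWatchmanRoute f)
    (hfin : pathLength f ≠ ⊤) {τ : ℝ} (hτ : τ ∈ Icc (0 : ℝ) 1) (hτab : τ ∉ Icc a b)
    (hτi : O.side i (f τ) ≤ 0) :
    ∃ g : ℝ → Plane, O.IsWatchmanRoute g ∧ g 0 = f 0 ∧ pathLength g < pathLength f := by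
  obtain ⟨hp, hvis⟩ := O.isWatchmanRoute_iff.1 hf
  obtain ⟨m, hm, hmj⟩ := h.exists_push
  obtain ⟨ρ, hρ, hball⟩ := Metric.eventually_nhds_iff_ball.1 (O.eventually_side_sign (f t))
  obtain ⟨δ₀, hδ₀, hnear⟩ := h.near
  obtain ⟨δ, hδ, hδδ₀, hδρ⟩ : ∃ δ > (0 : ℝ), δ ≤ δ₀ ∧ δ < ρ :=
    ⟨min δ₀ (ρ / 2), by positivity, min_le_left _ _, (min_le_right _ _).trans_lt (by linarith)⟩
  obtain ⟨a', ha', b', hb', ea, eb, hd⟩ := hnear δ hδ hδδ₀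
  have hab : a' < b' := ha'.2.trans hb'.1
  have ha0 : 0 ≤ a' := h.nonneg.trans ha'.1
  have hb1 : b' ≤ 1 := hb'.2.trans h.le_one
  have hin : ∀ r ∈ Icc a' b', f r ∈ Metric.ball (f t) ρ := fun r hr =>
    Metric.mem_ball.2 ((hd r hr).trans_lt hδρ)
  have hXY : 0 < inner ℝ (δ • x + δ • y) m := by
    rw [← smul_add, real_inner_smul_left]
    exact mul_pos hδ (h.inner_pos hm)
  obtain ⟨ε, ⟨hε1, hε2⟩, hε⟩ : ∃ ε : ℝ, (ε * ‖m‖ ^ 2 < inner ℝ (δ • x + δ • y) m ∧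
      f t + ε • m ∈ Metric.ball (f t) ρ) ∧ 0 < ε := by
    have c1 : Continuous fun ε : ℝ => ε * ‖m‖ ^ 2 := by fun_prop
    have c2 : Continuous fun ε : ℝ => f t + ε • m := by fun_prop
    have e1 := (c1.tendsto 0).eventually 
      (gt_mem_nhds (show (0 : ℝ) * ‖m‖ ^ 2 < inner ℝ (δ • x + δ • y) m by simpa using hXY))
    have e2 := (c2.tendsto 0).eventually (Metric.ball_mem_nhds (f t + (0 : ℝ) • m) hρ)
    rw [zero_smul, add_zero] at e2
    exact (((e1.and e2).filter_mono nhdsWithin_le_nhds).and self_mem_nhdsWithin).exists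
      (f := nhdsWithin 0 (Ioi 0))
  set q := f t + ε • m with hq
  have hqj : ∀ j ≠ i, O.side j (f t) ≤ 0 → O.side j q ≤ 0 := by
    intro j hji hj
    rcases hj.lt_or_eq with hj | hj
    · exact ((hball q hε2 j).2 hj).le
    · rw [hq, side_add, hj, cross_smul, zero_add]
      exact (mul_neg_of_pos_of_neg hε (hmj j hji hj)).le
  have hclose : ∀ r ∈ Icc a' b', 0 < O.side i (f r) →
      ∃ k ≠ i, O.side k (f r) ≤ 0 ∧ O.side k (f t) ≤ 0 := by
    intro r hr hpos
    obtain ⟨k, hk⟩ := O.mem_freeSpace.1 (hp.2 (⟨ha0.trans hr.1, hr.2.trans hb1⟩ : r ∈ Icc (0 : ℝ) 1))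
    refine ⟨k, fun e => ?_, hk, ?_⟩
    · rw [e] at hk; exact absurd hpos hk.not_gt
    · by_contra! hk'
      exact absurd ((hball _ (hin r hr) k).1 hk') hk.not_gt
  have hla : a' ∈ Icc a' b' := left_mem_Icc.2 hab.le
  have hrb : b' ∈ Icc a' b' := right_mem_Icc.2 hab.le
  -- The detour is free because one half plane contains its ends and the new bend: either one with
  -- `f t` in its interior, or the only other one whose line passes through `f t`.
  obtain ⟨j, hja, hjq, hjb⟩ : ∃ j, O.side j (f a') ≤ 0 ∧ O.side j q ≤ 0 ∧ O.side j (f b') ≤ 0 := by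
    by_cases hk : ∃ k, O.side k (f t) < 0
    · obtain ⟨k, hk⟩ := hk
      exact ⟨k, ((hball _ (hin _ hla) k).2 hk).le, ((hball _ hε2 k).2 hk).le,
        ((hball _ (hin _ hrb) k).2 hk).le⟩
    · push Not at hk
      obtain ⟨k, hki, hka, hkt⟩ := hclose a' hla (by
        rw [ea, h.side_add_smul]; exact mul_pos hδ h.cross_in)
      obtain ⟨l, hli, hlb, hlt⟩ := hclose b' hrb (by
        rw [eb, h.side_add_smul]; exact mul_pos hδ h.cross_out)
      obtain rfl : k = l := by
        by_contra hkl
        exact O.not_concurrent (Ne.symm hki) (Ne.symm hli) hkl h.side_eq (hkt.antisymm (hk k))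
          (hlt.antisymm (hk l))
      exact ⟨k, hka, hqj k hki hkt, hlb⟩
  obtain ⟨g, hg, hgf, ⟨rq, hrq, hgq⟩, hlen⟩ := O.exists_detour hp ha0 hab hb1
    (O.segment_subset_freeSpace hja hjq) (O.segment_subset_freeSpace hjq hjb)
  refine ⟨g, O.isWatchmanRoute_iff.2 ⟨hg, fun k => ?_⟩, hgf 0 (Or.inl ha0), hlen.trans_lt ?_⟩
  · by_cases hki : k = i
    · subst hki
      -- The visit at `τ` makes up for leaving `H i` at the bend. The other half planes visited
      -- during the replaced part contain `q`.
      refine ⟨τ, hτ, ?_⟩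
      rw [hgf τ]
      · exact hτi
      · by_contra! hcon
        exact hτab ⟨ha'.1.trans hcon.1.le, hcon.2.le.trans hb'.2⟩
    · obtain ⟨r, hr, hrk⟩ := hvis k
      by_cases hout : r ≤ a' ∨ b' ≤ r
      · exact ⟨r, hr, by rwa [hgf r hout]⟩
      · push Not at hout
        refine ⟨rq, hrq, ?_⟩
        rw [hgq]
        refine hqj k hki ?_
        by_contra! hk
        exact absurd ((hball _ (hin r ⟨hout.1.le, hout.2.le⟩) k).1 hk) hrk.not_gt
  · refine lt_of_lt_of_le ?_ (le_pathLength_of_mem (f := f) ha0 ha'.2.le hb'.1.le hb1)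
    have f0 : eVariationOn f (Icc 0 a') ≠ ⊤ :=
      ne_top_of_le_ne_top hfin (eVariationOn.mono f (Icc_subset_Icc_right (by linarith)))
    have f1 : eVariationOn f (Icc b' 1) ≠ ⊤ :=
      ne_top_of_le_ne_top hfin (eVariationOn.mono f (Icc_subset_Icc_left (by linarith)))
    refine ENNReal.add_lt_add_left f0 ?_
    rw [← add_assoc, ← add_assoc]
    refine ENNReal.add_lt_add_right f1 ?_
    have hlt := norm_sub_add_norm_sub_lt (x := δ • x) (y := δ • y) hδ
      (by rw [norm_smul, h.norm_in, Real.norm_of_nonneg hδ.le, mul_one])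
      (by rw [norm_smul, h.norm_out, Real.norm_of_nonneg hδ.le, mul_one]) hε hε1
    simp only [edist_dist]
    rw [← ENNReal.ofReal_add dist_nonneg dist_nonneg, ← ENNReal.ofReal_add dist_nonneg dist_nonneg]
    have d1 : dist (f a') q = ‖δ • x - ε • m‖ := by rw [dist_eq_norm, ea, hq]; congr 1; abel
    have d2 : dist q (f b') = ‖δ • y - ε • m‖ := by
      rw [dist_comm, dist_eq_norm, eb, hq]; congr 1; abel
    have d3 : dist (f a') (f t) = δ := by
      rw [dist_eq_norm, ea, add_sub_cancel_left, norm_smul, h.norm_in, Real.norm_of_nonneg hδ.le,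
        mul_one]
    have d4 : dist (f t) (f b') = δ := by
      rw [dist_comm, dist_eq_norm, eb, add_sub_cancel_left, norm_smul, h.norm_out,
        Real.norm_of_nonneg hδ.le, mul_one]
    rw [d1, d2, d3, d4]
    exact (ENNReal.ofReal_lt_ofReal_iff (by linarith)).2 hlt

/-- The runs overlap in time, and one common point other than `f t` determines the direction. On the
outgoing side the path may rest, so the earlier of two times at positive distance is used. -/
lemma out_eq {j : Fin n} {a' b' : ℝ} {x' y' : Plane} (h : O.Reflects f i t a b x y)
    (h' : O.Reflects f j t a' b' x' y') : x = x' ∧ y = y' := by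
  have key : ∀ {c c' : ℝ} {z z' : Plane}, 0 < c → 0 ≤ c' → ‖z‖ = 1 → ‖z'‖ = 1 →
      f t + c • z = f t + c' • z' → z = z' := by
    intro c c' z z' hc hc' hz hz' e
    have e' := add_left_cancel e
    have hn := congrArg norm e'
    rw [norm_smul, norm_smul, hz, hz', Real.norm_of_nonneg hc.le, Real.norm_of_nonneg hc', mul_one,
      mul_one] at hn
    rw [← hn] at e'
    exact smul_right_injective _ hc.ne' e'
  constructor
  · obtain ⟨c, hc, e⟩ := h.before (max a a') ⟨le_max_left _ _, max_lt h.lt_time h'.lt_time⟩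
    obtain ⟨c', hc', e'⟩ := h'.before (max a a') ⟨le_max_right _ _, max_lt h.lt_time h'.lt_time⟩
    exact key hc hc'.le h.norm_in h'.norm_in (e.symm.trans e')
  · obtain ⟨δ, hδ, hn⟩ := h.near
    obtain ⟨δ', hδ', hn'⟩ := h'.near
    obtain ⟨-, -, r, hr, -, e, -⟩ := hn δ hδ le_rfl
    obtain ⟨-, -, r', hr', -, e', -⟩ := hn' δ' hδ' le_rfl
    rcases le_total r r' with hrr | hrr
    · obtain ⟨c, hc, e2⟩ := h'.after r ⟨hr.1.le, hrr.trans hr'.2⟩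
      exact key hδ hc h.norm_out h'.norm_out (e.symm.trans e2)
    · obtain ⟨c, hc, e2⟩ := h.after r' ⟨hr'.1.le, hrr.trans hr.2⟩
      exact (key hδ' hc h'.norm_out h.norm_out (e'.symm.trans e2)).symm

/-- At a given time there is at most one reflection. -/
lemma index_eq {j : Fin n} {a' b' : ℝ} {x' y' : Plane} (h : O.Reflects f i t a b x y)
    (h' : O.Reflects f j t a' b' x' y') : i = j := by
  by_contra hij
  obtain ⟨rfl, rfl⟩ := h.out_eq h'
  have hc := O.cross_edgeDir_ne_zero hij h.side_eq h'.side_eq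
  have hi := h.inner_eq
  have hj := h'.inner_eq
  have hpos := h.cross_in
  have hpos' := h.cross_out
  simp only [PiLp.inner_apply, Fin.sum_univ_two, cross, RCLike.inner_apply, conj_trivial,
    PiLp.add_apply] at hi hj hc hpos hpos'
  -- Cramer's rule: `x + y` is orthogonal to two independent directions and so vanishes.
  have e0 : (x 0 + y 0) * (O.edgeDir i 0 * O.edgeDir j 1 - O.edgeDir i 1 * O.edgeDir j 0) = 0 := by
    linear_combination O.edgeDir j 1 * hi - O.edgeDir i 1 * hj
  have e1 : (x 1 + y 1) * (O.edgeDir i 0 * O.edgeDir j 1 - O.edgeDir i 1 * O.edgeDir j 0) = 0 := by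
    linear_combination O.edgeDir i 0 * hj - O.edgeDir j 0 * hi
  have z0 := (mul_eq_zero.1 e0).resolve_right hc
  have z1 := (mul_eq_zero.1 e1).resolve_right hc
  have : (O.edgeDir i 0 * x 1 - O.edgeDir i 1 * x 0) + (O.edgeDir i 0 * y 1 - O.edgeDir i 1 * y 0)
      = 0 := by linear_combination O.edgeDir i 0 * z1 - O.edgeDir i 1 * z0
  linarith

end Reflects

end ConvexPolygon

/-! ### Chords between edge midpoints as barriers for the path -/

lemma mul_pos_of_forall_ne_zero {F : ℝ → ℝ} {T r r' : ℝ} (hF : ContinuousOn F (Icc 0 T))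
    (h0 : ∀ r ∈ Icc 0 T, F r ≠ 0) (hr : r ∈ Icc 0 T) (hr' : r' ∈ Icc 0 T) : 0 < F r * F r' := by
  by_contra! hle
  obtain ⟨u, hu, h⟩ : (0 : ℝ) ∈ F '' Icc 0 T := by
    rcases lt_or_gt_of_ne (h0 r hr) with h | h
    · have : 0 ≤ F r' := by by_contra! h'; exact (mul_pos_of_neg_of_neg h h').not_ge hle
      exact isPreconnected_Icc.intermediate_value hr hr' hF ⟨h.le, this⟩
    · have : F r' ≤ 0 := by by_contra! h'; exact (mul_pos h h').not_ge hle
      exact isPreconnected_Icc.intermediate_value hr' hr hF ⟨this, h.le⟩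
  exact h0 u hu h

namespace ConvexPolygon

variable {n : ℕ} [NeZero n] (O : ConvexPolygon n)

/-- The signed position of `z` with respect to the chord joining the midpoints of two edges. -/
noncomputable def chord (i j : Fin n) (z : Plane) : ℝ :=
  cross (O.edgeMid j - O.edgeMid i) (z - O.edgeMid i)

lemma continuous_chord (i j : Fin n) : Continuous (O.chord i j) := continuous_cross_sub _ _

lemma chord_swap (i j : Fin n) (z : Plane) : O.chord j i z = -O.chord i j z := by
  simp only [chord, cross, PiLp.sub_apply]
  ring

/-- Exchanging two vertices reverses the orientation of the triangle of midpoints; this sign yields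
the contradiction in `exists_visit_before`. -/
lemma chord_edgeMid_swap (i j k : Fin n) :
    O.chord i k (O.edgeMid j) = -O.chord i j (O.edgeMid k) := cross_swap _ _

/-- For `j ≠ i` the last factor is positive, so on the line of edge `i` the sign does not depend on
`j`. -/
lemma chord_add_smul_edgeDir (i j : Fin n) (c : ℝ) :
    O.chord i j (O.edgeMid i + c • O.edgeDir i) = -c * O.side i (O.edgeMid j) := by
  rw [O.side_eq_of_side_eq_zero (O.side_edgeMid_self i), chord, add_sub_cancel_left, cross_smul,
    cross_swap]
  ring

/-- Between the lines of two edges a chord joining them lies in the obstacle. -/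
lemma side_pos_of_chord_eq_zero {i j : Fin n} (hij : i ≠ j) {z : Plane} (hz : O.chord i j z = 0)
    (hi : 0 < O.side i z) (hj : 0 < O.side j z) (k : Fin n) : 0 < O.side k z := by
  have hne : O.edgeMid j - O.edgeMid i ≠ 0 := fun h => by
    have := O.side_edgeMid_pos hij.symm
    rw [sub_eq_zero.1 h, side_edgeMid_self] at this
    exact lt_irrefl _ this
  obtain ⟨c, hc⟩ := exists_eq_smul_of_cross_eq_zero hne hz
  have hz' : z = AffineMap.lineMap (O.edgeMid i) (O.edgeMid j) c := by
    rw [AffineMap.lineMap_apply, vsub_eq_sub, ← hc]; simp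
  have hji := O.side_edgeMid_pos hij.symm
  have hij' := O.side_edgeMid_pos hij
  rw [hz', side_lineMap, side_edgeMid_self, mul_zero, zero_add] at hi
  rw [hz', side_lineMap, side_edgeMid_self, mul_zero, add_zero] at hj
  have c0 : 0 < c := pos_of_mul_pos_left hi hji.le
  have c1 : 0 < 1 - c := pos_of_mul_pos_left hj hij'.le
  rw [hz', side_lineMap]
  by_cases hk : i = k
  · rw [← hk, side_edgeMid_self]
    linarith
  · exact add_pos_of_pos_of_nonneg (mul_pos c1 (O.side_edgeMid_pos hk))
      (mul_nonneg c0.le (O.side_edgeMid_nonneg k j))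

/-- Between the lines of two edges, a third half plane lies on the same side of the chord as the
third edge. -/
lemma chord_mul_chord_pos {i j k : Fin n} (hij : i ≠ j) (hik : i ≠ k) (hjk : j ≠ k) {z : Plane}
    (hk : O.side k z ≤ 0) (hi : 0 ≤ O.side i z) (hj : 0 ≤ O.side j z) (hz : O.chord i j z ≠ 0) :
    0 < O.chord i j z * O.chord i j (O.edgeMid k) := by
  have hi' := O.side_edgeMid_pos hik.symm
  have hj' := O.side_edgeMid_pos hjk.symm
  have hne : O.chord i j (O.edgeMid k) ≠ 0 := fun h => by
    have := O.side_pos_of_chord_eq_zero hij h hi' hj' k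
    rw [side_edgeMid_self] at this
    exact lt_irrefl _ this
  by_contra! hle
  have hlt := hle.lt_of_ne (mul_ne_zero hz hne)
  set A := O.chord i j z
  set B := O.chord i j (O.edgeMid k)
  -- If `z` and the midpoint of edge `k` were on opposite sides, their segment would meet the chord
  -- at parameter A / (A - B), a point of the obstacle, although it lies in `H k`. Expanding the
  -- fraction by A avoids a case split on signs.
  have hA : 0 < A ^ 2 := by positivity
  have hD : 0 < A ^ 2 - A * B := by linarith
  have s0 : 0 < A ^ 2 / (A ^ 2 - A * B) := div_pos hA hD
  have s1 : 0 < 1 - A ^ 2 / (A ^ 2 - A * B) := by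
    rw [sub_pos, div_lt_one hD]; linarith
  have hy : O.chord i j (AffineMap.lineMap z (O.edgeMid k) (A ^ 2 / (A ^ 2 - A * B))) = 0 := by
    have : O.chord i j (AffineMap.lineMap z (O.edgeMid k) (A ^ 2 / (A ^ 2 - A * B))) =
      (1 - A ^ 2 / (A ^ 2 - A * B)) * A + A ^ 2 / (A ^ 2 - A * B) * B := cross_lineMap _ _ _ _ _
    rw [this, one_sub_div hD.ne', div_mul_eq_mul_div, div_mul_eq_mul_div, ← add_div]
    exact div_eq_zero_iff.2 (Or.inl (by ring))
  have := O.side_pos_of_chord_eq_zero hij hy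
    (by rw [side_lineMap]; exact add_pos_of_nonneg_of_pos (mul_nonneg s1.le hi) (mul_pos s0 hi'))
    (by rw [side_lineMap]; exact add_pos_of_nonneg_of_pos (mul_nonneg s1.le hj) (mul_pos s0 hj')) k
  rw [side_lineMap, side_edgeMid_self] at this
  nlinarith [mul_nonneg s1.le (neg_nonneg.2 hk)]

namespace Reflects

variable {O} {f : ℝ → Plane} {i j : Fin n} {t a b : ℝ} {x y : Plane}

/-- A bend lies in a second half plane, the midpoint of edge `i` in none but `H i`. -/
lemma exists_eq_edgeMid_add (h : O.Reflects f i t a b x y) (hf : O.IsPath f) :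
    ∃ c : ℝ, c ≠ 0 ∧ f t = O.edgeMid i + c • O.edgeDir i := by
  obtain ⟨c, hc⟩ := O.exists_edgeMid_sub_eq_smul h.side_eq
  refine ⟨c, ?_, hc⟩
  rintro rfl
  obtain ⟨k, hki, hk⟩ := h.exists_side_nonpos hf
  rw [hc, zero_smul, add_zero] at hk
  exact hk.not_gt (O.side_edgeMid_pos hki.symm)

lemma chord_ne_zero (h : O.Reflects f i t a b x y) (hf : O.IsPath f) (hij : i ≠ j) :
    O.chord i j (f t) ≠ 0 := by
  obtain ⟨c, hc, e⟩ := h.exists_eq_edgeMid_add hf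
  rw [e, chord_add_smul_edgeDir]
  exact mul_ne_zero (neg_ne_zero.2 hc) (O.side_edgeMid_pos hij.symm).ne'

/-- A path that visits two half planes only by reflecting off them has seen all other half planes
by the time of the second reflection, if it sees them at all. -/
lemma exists_visit_before {t' a' b' : ℝ} {x' y' : Plane} (h : O.Reflects f i t a b x y)
    (h' : O.Reflects f j t' a' b' x' y') (hf : O.IsPath f) (hij : i ≠ j) (htt : t ≤ t')
    (hi : ∀ r ∈ Icc (0 : ℝ) 1, O.side i (f r) ≤ 0 → f r = f t)
    (hj : ∀ r ∈ Icc (0 : ℝ) 1, O.side j (f r) ≤ 0 → f r = f t') {k : Fin n} {τ : ℝ}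
    (hτ : τ ∈ Icc (0 : ℝ) 1) (hkτ : O.side k (f τ) ≤ 0) :
    ∃ r ∈ Icc 0 t', O.side k (f r) ≤ 0 := by
  by_contra! hk
  have ht := h.time_mem
  have ht' := h'.time_mem
  have htm : t ∈ Icc 0 t' := ⟨ht.1, htt⟩
  have htm' : t' ∈ Icc 0 t' := ⟨ht'.1, le_rfl⟩
  have hik : i ≠ k := by
    rintro rfl
    exact (hk t htm).ne' h.side_eq
  have hjk : j ≠ k := by
    rintro rfl
    exact (hk t' htm').ne' h'.side_eq
  have hsub : Icc 0 t' ⊆ Icc (0 : ℝ) 1 := Icc_subset_Icc_right ht'.2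
  have hi0 : ∀ r ∈ Icc (0 : ℝ) 1, 0 ≤ O.side i (f r) := fun r hr => by
    by_contra! hneg
    rw [hi r hr hneg.le, h.side_eq] at hneg
    exact lt_irrefl _ hneg
  have hj0 : ∀ r ∈ Icc (0 : ℝ) 1, 0 ≤ O.side j (f r) := fun r hr => by
    by_contra! hneg
    rw [hj r hr hneg.le, h'.side_eq] at hneg
    exact lt_irrefl _ hneg
  have hfree : ∀ r ∈ Icc (0 : ℝ) 1, ¬ ∀ l, 0 < O.side l (f r) := fun r hr hall => by
    obtain ⟨l, hl⟩ := O.mem_freeSpace.1 (hf.2 hr)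
    exact hl.not_gt (hall l)
  have hcij : ∀ r ∈ Icc (0 : ℝ) 1, O.chord i j (f r) ≠ 0 := fun r hr h0 => by
    rcases le_or_gt (O.side i (f r)) 0 with h1 | h1
    · exact h.chord_ne_zero hf hij (hi r hr h1 ▸ h0)
    rcases le_or_gt (O.side j (f r)) 0 with h2 | h2
    · refine h'.chord_ne_zero hf hij.symm ?_
      rw [chord_swap, ← hj r hr h2, h0, neg_zero]
    exact hfree r hr (O.side_pos_of_chord_eq_zero hij h0 h1 h2)
  -- Only up to `t'` is `H k` known to be avoided, so this barrier holds only on `[0, t']`.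
  have hcik : ∀ r ∈ Icc 0 t', O.chord i k (f r) ≠ 0 := fun r hr h0 => by
    rcases le_or_gt (O.side i (f r)) 0 with h1 | h1
    · exact h.chord_ne_zero hf hik (hi r (hsub hr) h1 ▸ h0)
    exact hfree r (hsub hr) (O.side_pos_of_chord_eq_zero hik h0 h1 (hk r hr))
  have e1 := mul_pos_of_forall_ne_zero ((O.continuous_chord i j).comp_continuousOn hf.1) hcij ht hτ
  have e2 := O.chord_mul_chord_pos hij hik hjk hkτ (hi0 τ hτ) (hj0 τ hτ) (hcij τ hτ)
  have e3 := mul_pos_of_forall_ne_zero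
    ((O.continuous_chord i k).comp_continuousOn (hf.1.mono hsub)) hcik htm htm'
  have e4 := O.chord_mul_chord_pos hik hij hjk.symm h'.side_eq.le (hi0 t' ht') (hk t' htm').le
    (hcik t' htm')
  have e5 : 0 < O.chord i j (f t) * O.chord i k (f t) := by
    obtain ⟨c, hc, e⟩ := h.exists_eq_edgeMid_add hf
    rw [e, chord_add_smul_edgeDir, chord_add_smul_edgeDir]
    have := mul_pos (sq_pos_of_ne_zero hc)
      (mul_pos (O.side_edgeMid_pos hij.symm) (O.side_edgeMid_pos hik.symm))
    linarith
  rw [chord_edgeMid_swap] at e4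
  simp only [Function.comp_apply] at e1 e3
  -- Each of the five chord values occurs twice, and `e4` contributes one minus sign: the product is
  -- minus a square.
  have := mul_pos (mul_pos (mul_pos e1 e2) (mul_pos e3 e4)) e5
  nlinarith [sq_nonneg (O.chord i j (f t) * O.chord i j (f τ) * O.chord i j (O.edgeMid k) *
    O.chord i k (f t) * O.chord i k (f t'))]

end Reflects

/-- A route that has visited all half planes before its last move can be truncated. -/
lemma exists_shorter_of_visit_before {f : ℝ → Plane} (hf : O.IsPath f) (hfin : pathLength f ≠ ⊤)
    {t r : ℝ} (ht : 0 ≤ t) (htr : t ≤ r) (hr : r ≤ 1) (hne : f t ≠ f r)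
    (hvis : ∀ k, ∃ u ∈ Icc 0 t, O.side k (f u) ≤ 0) :
    ∃ g : ℝ → Plane, O.IsWatchmanRoute g ∧ g 0 = f 0 ∧ pathLength g < pathLength f := by
  have hmap : MapsTo (fun u : ℝ => t * u) (Icc 0 1) (Icc 0 1) := fun u hu =>
    ⟨mul_nonneg ht hu.1, mul_le_one₀ (htr.trans hr) hu.1 hu.2⟩
  refine ⟨fun u => f (t * u), O.isWatchmanRoute_iff.2
    ⟨⟨hf.1.comp (by fun_prop) hmap, hf.2.comp hmap⟩, fun k => ?_⟩, by simp, ?_⟩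
  · obtain ⟨u, hu, hk⟩ := hvis k
    rcases ht.eq_or_lt with rfl | ht
    · refine ⟨0, by simp, ?_⟩
      obtain rfl : u = 0 := le_antisymm hu.2 hu.1
      rwa [mul_zero]
    · refine ⟨u / t, ⟨div_nonneg hu.1 ht.le, (div_le_one ht).2 hu.2⟩, ?_⟩
      rwa [mul_div_cancel₀ _ ht.ne']
  · have hsplit := eVariationOn_Icc_add (f := f) ht (htr.trans hr)
    have hpos : 0 < eVariationOn f (Icc t 1) := (edist_pos.2 hne).trans_le
      (eVariationOn.edist_le f ⟨le_rfl, htr.trans hr⟩ ⟨htr, hr⟩)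
    rw [pathLength, eVariationOn_comp_mul f ht, pathLength, ← hsplit]
    refine ENNReal.lt_add_right ?_ hpos.ne'
    exact ne_top_of_le_ne_top hfin (eVariationOn.mono f (Icc_subset_Icc_right (htr.trans hr)))

/-- A route with reflections at two different times can be shortened. -/
lemma exists_shorter_of_reflects {f : ℝ → Plane} (hf : O.IsWatchmanRoute f)
    (hfin : pathLength f ≠ ⊤) {i j : Fin n} {t a b t' a' b' : ℝ} {x y x' y' : Plane}
    (h : O.Reflects f i t a b x y) (h' : O.Reflects f j t' a' b' x' y') (htt : t < t') :
    ∃ g : ℝ → Plane, O.IsWatchmanRoute g ∧ g 0 = f 0 ∧ pathLength g < pathLength f := by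
  obtain ⟨hp, hvis⟩ := O.isWatchmanRoute_iff.1 hf
  by_cases hi : ∃ τ ∈ Icc (0 : ℝ) 1, τ ∉ Icc a b ∧ O.side i (f τ) ≤ 0
  · obtain ⟨τ, hτ, hτab, hτi⟩ := hi
    exact h.exists_shorter hf hfin hτ hτab hτi
  by_cases hj : ∃ τ ∈ Icc (0 : ℝ) 1, τ ∉ Icc a' b' ∧ O.side j (f τ) ≤ 0
  · obtain ⟨τ, hτ, hτab, hτj⟩ := hj
    exact h'.exists_shorter hf hfin hτ hτab hτj
  push Not at hi hj
  have hi' : ∀ r ∈ Icc (0 : ℝ) 1, O.side i (f r) ≤ 0 → f r = f t := fun r hr hs => by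
    by_cases hrab : r ∈ Icc a b
    · exact h.eq_of_side_nonpos hrab hs
    · exact absurd hs (hi r hr hrab).not_ge
  have hj' : ∀ r ∈ Icc (0 : ℝ) 1, O.side j (f r) ≤ 0 → f r = f t' := fun r hr hs => by
    by_cases hrab : r ∈ Icc a' b'
    · exact h'.eq_of_side_nonpos hrab hs
    · exact absurd hs (hj r hr hrab).not_ge
  -- For `i = j`, time `t` is either a visit outside `[a', b']` or lies on the incoming run of the
  -- second reflection, strictly outside the half plane.
  have hij : i ≠ j := by
    rintro rfl
    by_cases hta : t ∈ Icc a' b'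
    · obtain ⟨c, hc, e⟩ := h'.before t ⟨hta.1, htt⟩
      have hs := h.side_eq
      rw [e, h'.side_add_smul] at hs
      exact (mul_pos hc h'.cross_in).ne' hs
    · exact (hj t h.time_mem hta).ne' h.side_eq
  -- The outgoing run moves away from `f t'`, so cutting at `t'` saves a positive length.
  obtain ⟨δ, hδ, hn⟩ := h'.near
  obtain ⟨-, -, r, hr, -, e, -⟩ := hn δ hδ le_rfl
  refine O.exists_shorter_of_visit_before hp hfin h'.time_mem.1 hr.1.le (hr.2.trans h'.le_one)
    (fun e' => ?_) fun k => ?_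
  · have hs := h'.side_add_smul δ y'
    rw [← e, ← e', h'.side_eq] at hs
    exact (mul_pos hδ h'.cross_out).ne hs
  · obtain ⟨τ, hτ, hk⟩ := hvis k
    exact h.exists_visit_before h' hp hij htt.le hi' hj' hτ hk

/-! ### Conclusion: infinite length, and reflections at equal or different times -/

lemma exists_shorter_of_two_le_encard {f : ℝ → Plane} (hf : O.IsWatchmanRoute f)
    (h2 : 2 ≤ (O.reflections f).encard) :
    ∃ g : ℝ → Plane, O.IsWatchmanRoute g ∧ g 0 = f 0 ∧ pathLength g < pathLength f := by
  by_cases hfin : pathLength f = ⊤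
  · obtain ⟨g, hg, h0, hlen⟩ := O.exists_finite_route (hf.1.2 (left_mem_Icc.2 (zero_le_one' ℝ)))
    exact ⟨g, hg, h0, hfin ▸ hlen.lt_top⟩
  obtain ⟨⟨i, t⟩, ⟨j, t'⟩, h1, h1', hne⟩ :=
    one_lt_encard_iff.1 (lt_of_lt_of_le (by norm_num : (1 : ℕ∞) < 2) h2)
  obtain ⟨a, b, x, y, h⟩ := IsReflection.exists_reflects hf.1.1 h1
  obtain ⟨a', b', x', y', h'⟩ := IsReflection.exists_reflects hf.1.1 h1'
  dsimp only at h h'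
  rcases lt_trichotomy t t' with htt | rfl | htt
  · exact O.exists_shorter_of_reflects hf hfin h h' htt
  · exact absurd (congrArg (·, t) (h.index_eq h')) hne
  · exact O.exists_shorter_of_reflects hf hfin h' h htt

end ConvexPolygon

theorem mainTheorem8 (n : ℕ) [NeZero n] (O : ConvexPolygon n) (s : Plane)
    (hs : s ∈ O.freeSpace) :
    (∀ f : ℝ → Plane, O.IsOptimalWatchmanRoute s f → (O.reflections f).encard ≤ 1) ∧
    (∀ f : ℝ → Plane, O.IsWatchmanRoute f → f 0 = s → 2 ≤ (O.reflections f).encard →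
      ∃ g : ℝ → Plane, O.IsWatchmanRoute g ∧ g 0 = s ∧ pathLength g < pathLength f) := by
  have key : ∀ f : ℝ → Plane, O.IsWatchmanRoute f → f 0 = s → 2 ≤ (O.reflections f).encard →
      ∃ g : ℝ → Plane, O.IsWatchmanRoute g ∧ g 0 = s ∧ pathLength g < pathLength f := by
    rintro f hf rfl h2
    exact O.exists_shorter_of_two_le_encard hf h2
  refine ⟨fun f ⟨hf, h0, hopt⟩ => ?_, key⟩
  by_contra! hlt
  obtain ⟨g, hg, hg0, hlen⟩ := key f hf h0 (by
    rw [← one_add_one_eq_two]; exact Order.add_one_le_of_lt hlt)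
  exact hlen.not_ge (hopt g hg hg0)
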